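/- Let $0<\alpha<\tfrac14$, $\sigma:=1-2\alpha$ and $\eta\in\{0,1\}$. Let $h:\mathbb S^1\to(0,\infty)$ be a smooth positive solution of $h_{\theta\theta}+h=2\alpha\sigma\,h^{\frac{\alpha-1}{\alpha}}$. For $i=1,2$ let $\Sigma_i\subset\mathbb R^3$ be the graph $x_3=u_i(x)$ of a convex function $u_i:\mathbb R^2\to\mathbb R$ which is an Alexandrov solution of $$\det D^2u=(\eta+|Du|^2)^{2-\frac1{2\alpha}}\quad\text{on }\mathbb R^2,$$ that is, $|\partial u_i(E)|=\int_E(\eta+|Du_i(x)|^2)^{2-\frac1{2\alpha}}\,dx$ for every Borel set $E\subset\mathbb R^2$, where $\partial u_i(E)$ is the union of the subdifferentials of $u_i$ at the points of $E$, $|\cdot|$ is Lebesgue measure, and the integrand is $+\infty$ where $\eta+|Du_i|^2=0$. Let $S_i(l,\theta):=\sup_{\{u_i(x)=l\}}\langle x,(\cos\theta,\sin\theta)\rangle$ be the support function of the level set of $u_i$ at height $l$. Suppose that, uniformly for $\theta\in\mathbb S^1$ as $l\to\infty$, $$S_i(l,\theta)=\sigma^{-1}l^{\sigma}h(\theta)+o(l^{\sigma})\quad(i=1,2),\qquad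 S_1(l,\theta)-S_2(l,\theta)=o(l^{-2\alpha}).$$ Then $\Sigma_1=\Sigma_2$. -/

import Mathlib

open MeasureTheory Filter
open scoped ContDiff

/-- The Euclidean plane. -/
abbrev Plane : Type := EuclideanSpace ℝ (Fin 2)

/-- The subdifferential `∂u(x)` of a function on the whole plane. -/
def subdifferential (u : Plane → ℝ) (x : Plane) : Set Plane :=
  {p | ∀ y : Plane, u x + inner ℝ p (y - x) ≤ u y}

/-- The normal image `∂u(E) = ⋃_{x ∈ E} ∂u(x)`; its area is the Monge–Ampère measure of `E`. -/
def normalImage (u : Plane → ℝ) (E : Set Plane) : Set Plane :=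
  ⋃ x ∈ E, subdifferential u x

/-- The right-hand side `(η + |p|²)^{2 - 1/(2α)}`, with values in `[0, ∞]`. The exponent is
negative for `0 < α < 1/4`, so that for `η = 0` the value at `p = 0` is `∞`. -/
noncomputable def translatorRHS (α η : ℝ) (p : Plane) : ENNReal :=
  ENNReal.ofReal (η + ‖p‖ ^ 2) ^ (2 - 1 / (2 * α))

/-- `u` is an entire (convex) Alexandrov solution of `det D²u = (η + |Du|²)^{2 - 1/(2α)}`: it is
convex and its Monge–Ampère measure is the right-hand side times Lebesgue measure. A convex
function is differentiable almost everywhere, so that the value which `gradient` takes at the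
other points does not matter. -/
def IsAlexandrovSolution (α η : ℝ) (u : Plane → ℝ) : Prop :=
  ConvexOn ℝ Set.univ u ∧
    ∀ E : Set Plane, MeasurableSet E →
      volume (normalImage u E) = ∫⁻ x in E, translatorRHS α η (gradient u x)

/-- The support function of the level sets of `u`:
`S(l, θ) = sup_{u(x) = l} ⟨x, (cos θ, sin θ)⟩`. -/
noncomputable def levelSupport (u : Plane → ℝ) (l θ : ℝ) : ℝ :=
  sSup ((fun x : Plane => (inner ℝ x !₂[Real.cos θ, Real.sin θ] : ℝ)) '' {x | u x = l})

/-- `h` is the support function of a shrinker: a smooth positive function on the circle (that is,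
`2π`-periodic) with `h'' + h = 2 α σ h^{(α - 1)/α}`, where `σ = 1 - 2 α`. -/
structure IsShrinkerSupport (α : ℝ) (h : ℝ → ℝ) : Prop where
  smooth : ContDiff ℝ ∞ h
  periodic : Function.Periodic h (2 * Real.pi)
  pos : ∀ θ, 0 < h θ
  equation : ∀ θ, iteratedDeriv 2 h θ + h θ = 2 * α * (1 - 2 * α) * h θ ^ ((α - 1) / α)

/-- `f(l, θ) = o(l^γ)` as `l → ∞`, uniformly in `θ`. -/
def UniformLittleO (f : ℝ → ℝ → ℝ) (γ : ℝ) : Prop :=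
  ∀ ε > 0, ∀ᶠ l : ℝ in atTop, ∀ θ : ℝ, |f l θ| ≤ ε * l ^ γ

/-!
Put `w(p) = (η + |p|²)^(1/(2α) - 2)`, the reciprocal of the right-hand side. In the dual variable
the equation no longer involves the unknown function: the normal image `∂u(E)` of a Borel set `E`
has `w`-weighted area `|E|` (`lintegral_normalImage_inv`). This needs no regularity of `u`, since the
points of non-differentiability carry no Monge–Ampère mass and at all others the only subgradient
is the gradient.

Comparison then follows Aleksandrov's and McCann's uniqueness argument for monotone maps. Suppose
that `M = {u > v + c}` is bounded and that every slope is a subgradient of `v`. A slope of `u` at a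
point of `M` is a slope of `v` only at points of `M`. If `u` and `v` had different gradients at a
point of `{u = v + c}`, such slopes would not occur for `v` in a whole neighbourhood of that point,
which meets `M` in a set of positive area; so `∂v(M)` would have strictly more weighted area than
`∂u(M)`, while both have `|M|` (`gradient_eq_of_isBounded`). Hence `∇u = ∇v` almost everywhere on
`{u > v}`. When `{u > v + c}` is bounded for all `c > 0`, the functions `max (u - v - c) 0` are
Lipschitz with compact support and have zero derivative almost everywhere, so they vanish and
`u ≤ v` (`le_of_isBounded_setOf_add_lt`).

The asymptotics supply the two hypotheses, with `σ = 1 - 2α ∈ (1/2, 1)`. As `S(l, θ) = O(l^σ)` is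
`o(l)`, the functions grow superlinearly and have every slope (`exists_mem_subdifferential`). As
`S(·, θ)` is concave with leading term `σ⁻¹ l^σ h(θ)`, its increase between `l` and `l + ε` is at
least a constant times `ε l^(σ - 1) = ε l^(-2α)`, which dominates `S₁ - S₂ = o(l^(-2α))`. So far out
`{u₂ ≤ l}` lies in `{u₁ ≤ l + ε}` and conversely, that is, `u₁ - u₂ → 0` at infinity
(`isBounded_setOf_add_lt`).
-/

/-! ### Subgradients and the weighted area of the normal image -/

/-- At a point of differentiability, the gradient is the only possible subgradient. -/
theorem eq_gradient_of_mem_subdifferential {u : Plane → ℝ} {x p : Plane}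
    (hp : p ∈ subdifferential u x) (hu : DifferentiableAt ℝ u x) : p = gradient u x := by
  have hmin : IsLocalMin (fun y => u y - inner ℝ p y) x := by
    refine Eventually.of_forall fun y => ?_
    have := hp y
    rw [inner_sub_right] at this
    linarith
  have hd : HasFDerivAt (fun y => u y - inner ℝ p y)
      (fderiv ℝ u x - innerSL ℝ p) x :=
    hu.hasFDerivAt.sub (innerSL ℝ p).hasFDerivAt
  have h0 := hmin.hasFDerivAt_eq_zero hd
  refine ext_inner_right ℝ fun y => ?_
  have h1 := congrArg (fun L => L y) h0
  simp only [sub_apply, innerSL_apply_apply,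
    zero_apply] at h1
  have h2 : inner ℝ (gradient u x) y = fderiv ℝ u x y := by
    rw [← toDual_gradient, InnerProductSpace.toDual_apply_apply]
  rw [h2]
  linarith

theorem ConvexOn.ae_differentiableAt {u : Plane → ℝ} (hu : ConvexOn ℝ Set.univ u) :
    ∀ᵐ x, DifferentiableAt ℝ u x := by
  have hn : ∀ n : ℕ, ∀ᵐ x : Plane, x ∈ Metric.ball (0 : Plane) n → DifferentiableAt ℝ u x := by
    intro n
    obtain ⟨K, hK⟩ := (hu.locallyLipschitz.locallyLipschitzOn
      (s := Metric.closedBall (0 : Plane) n)).exists_lipschitzOnWith_of_compact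
        (isCompact_closedBall _ _)
    filter_upwards [hK.ae_differentiableWithinAt_of_mem (μ := volume)] with x hx hxn
    exact (hx (Metric.ball_subset_closedBall hxn)).differentiableAt
      (mem_of_superset (Metric.isOpen_ball.mem_nhds hxn) Metric.ball_subset_closedBall)
  filter_upwards [ae_all_iff.2 hn] with x hx
  obtain ⟨n, hn⟩ := exists_nat_gt ‖x‖
  exact hx n (by simpa using hn)

theorem measurable_gradient (u : Plane → ℝ) : Measurable (gradient u) :=
  (InnerProductSpace.toDual ℝ Plane).symm.continuous.measurable.comp (measurable_fderiv ℝ u)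

theorem measurable_translatorRHS (α η : ℝ) : Measurable (translatorRHS α η) := by
  unfold translatorRHS
  fun_prop

/-- The points of non-differentiability carry no Monge–Ampère mass, and at the other points the
gradient is the only subgradient; hence a piece of the normal image can be measured by pulling it
back under the gradient map. -/
theorem volume_restrict_normalImage {α η : ℝ} {u : Plane → ℝ} (hu : IsAlexandrovSolution α η u)
    {E : Set Plane} (hE : MeasurableSet E) :
    (volume : Measure Plane).restrict (normalImage u E) =
      (((volume : Measure Plane).restrict E).withDensity
        (fun x => translatorRHS α η (gradient u x))).map (gradient u) := by
  have hD : MeasurableSet {x | DifferentiableAt ℝ u x} := measurableSet_of_differentiableAt ℝ u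
  have hDc : volume ({x | DifferentiableAt ℝ u x}ᶜ) = 0 := hu.1.ae_differentiableAt
  have hN : volume (normalImage u ({x | DifferentiableAt ℝ u x}ᶜ)) = 0 := by
    rw [hu.2 _ hD.compl, setLIntegral_measure_zero _ _ hDc]
  ext F hF
  have hG : MeasurableSet (gradient u ⁻¹' F) := measurable_gradient u hF
  rw [Measure.restrict_apply hF, Measure.map_apply (measurable_gradient u) hF,
    withDensity_apply _ hG, Measure.restrict_restrict hG]
  have hset : normalImage u (gradient u ⁻¹' F ∩ E ∩ {x | DifferentiableAt ℝ u x}) ⊆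
      F ∩ normalImage u E := by
    intro p hp
    simp only [normalImage, Set.mem_iUnion] at hp ⊢
    obtain ⟨x, ⟨⟨hxF, hxE⟩, hxD⟩, hpx⟩ := hp
    refine ⟨?_, Set.mem_iUnion₂.2 ⟨x, hxE, hpx⟩⟩
    rw [eq_gradient_of_mem_subdifferential hpx hxD]
    exact hxF
  have hset' : F ∩ normalImage u E ⊆
      normalImage u (gradient u ⁻¹' F ∩ E ∩ {x | DifferentiableAt ℝ u x}) ∪
        normalImage u ({x | DifferentiableAt ℝ u x}ᶜ) := by
    rintro p ⟨hpF, hp⟩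
    simp only [normalImage, Set.mem_iUnion] at hp
    obtain ⟨x, hxE, hpx⟩ := hp
    by_cases hxD : DifferentiableAt ℝ u x
    · refine Or.inl (Set.mem_iUnion₂.2 ⟨x, ⟨⟨?_, hxE⟩, hxD⟩, hpx⟩)
      rw [Set.mem_preimage, ← eq_gradient_of_mem_subdifferential hpx hxD]
      exact hpF
    · exact Or.inr (Set.mem_iUnion₂.2 ⟨x, hxD, hpx⟩)
  have h1 : volume (F ∩ normalImage u E) =
      volume (normalImage u (gradient u ⁻¹' F ∩ E ∩ {x | DifferentiableAt ℝ u x})) := by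
    refine le_antisymm ((measure_mono hset').trans ((measure_union_le _ _).trans ?_))
      (measure_mono hset)
    rw [hN, add_zero]
  rw [h1, hu.2 _ ((hG.inter hE).inter hD)]
  exact setLIntegral_congr (inter_ae_eq_left_of_ae_eq_univ (ae_eq_univ.2 hDc))

/-- An Alexandrov solution has finite right-hand side almost everywhere: where the right-hand side
is infinite the gradient vanishes, and a single slope has zero area. -/
theorem ae_translatorRHS_gradient_ne_top {α η : ℝ} (hα₀ : 0 < α) (hα₁ : α < 1 / 4) (hη : 0 ≤ η)
    {u : Plane → ℝ} (hu : IsAlexandrovSolution α η u) :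
    ∀ᵐ x, translatorRHS α η (gradient u x) ≠ ⊤ := by
  have hexp : 2 - 1 / (2 * α) < 0 := by
    rw [sub_neg, lt_div_iff₀ (by positivity)]
    linarith
  have hT : ∀ p : Plane, translatorRHS α η p = ⊤ → p = 0 := by
    intro p hp
    rw [translatorRHS, ENNReal.rpow_eq_top_iff] at hp
    rcases hp with ⟨h0, -⟩ | ⟨-, h0⟩
    · rw [ENNReal.ofReal_eq_zero] at h0
      have : ‖p‖ ^ 2 = 0 := le_antisymm (by linarith) (by positivity)
      simpa using this
    · linarith
  have hmeas : Measurable fun x => translatorRHS α η (gradient u x) :=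
    (measurable_translatorRHS α η).comp (measurable_gradient u)
  have hfin : ∫⁻ x in gradient u ⁻¹' {0}, translatorRHS α η (gradient u x) = 0 := by
    have h := congrArg (fun μ : Measure Plane => μ {0})
      (volume_restrict_normalImage hu MeasurableSet.univ)
    rw [Measure.restrict_univ] at h
    simp only [Measure.map_apply (measurable_gradient u) (measurableSet_singleton (0 : Plane)),
      withDensity_apply _ (measurable_gradient u (measurableSet_singleton (0 : Plane)))] at h
    rw [← h]
    exact le_antisymm ((Measure.restrict_apply_le _ _).trans (by simp)) zero_le
  have hlt := ae_lt_top hmeas (μ := volume.restrict (gradient u ⁻¹' {0})) (by rw [hfin]; simp)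
  rw [ae_restrict_iff' (measurable_gradient u (measurableSet_singleton 0))] at hlt
  filter_upwards [hlt] with x hx htop
  exact (hx (hT _ htop)).ne htop

/-- In the dual variable the equation is linear: weighted by the reciprocal of the right-hand side,
the normal image of `E` has the area of `E`. -/
theorem lintegral_normalImage_inv {α η : ℝ} (hα₀ : 0 < α) (hα₁ : α < 1 / 4) (hη : 0 ≤ η)
    {u : Plane → ℝ} (hu : IsAlexandrovSolution α η u) {E : Set Plane} (hE : MeasurableSet E) :
    ∫⁻ p in normalImage u E, (translatorRHS α η p)⁻¹ = volume E := by
  have hmeas : Measurable fun x => translatorRHS α η (gradient u x) :=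
    (measurable_translatorRHS α η).comp (measurable_gradient u)
  have hne : ∀ p : Plane, translatorRHS α η p ≠ 0 := by
    intro p hp
    have hexp : 2 - 1 / (2 * α) < 0 := by
      rw [sub_neg, lt_div_iff₀ (by positivity)]
      linarith
    rw [translatorRHS, ENNReal.rpow_eq_zero_iff] at hp
    rcases hp with ⟨-, h⟩ | ⟨h, -⟩
    · linarith
    · exact ENNReal.ofReal_ne_top h
  rw [volume_restrict_normalImage hu hE,
    lintegral_map (f := fun p => (translatorRHS α η p)⁻¹) (measurable_translatorRHS α η).inv
      (measurable_gradient u),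
    lintegral_withDensity_eq_lintegral_mul _ hmeas
      (g := fun x => (translatorRHS α η (gradient u x))⁻¹) hmeas.inv, ← setLIntegral_one]
  refine lintegral_congr_ae (ae_restrict_of_ae ?_)
  filter_upwards [ae_translatorRHS_gradient_ne_top hα₀ hα₁ hη hu] with x hx
  exact ENNReal.mul_inv_cancel (hne _) hx

/-! ### The comparison principle -/

/-- If `gradient v x₀` is not a subgradient of `u` at a point `x₀` of `{u = v + c}`, then all affine
supports of `v + c` near `x₀` exceed `u` at one fixed point `z`. -/
theorem exists_eventually_lt_add_inner {u v : Plane → ℝ} (hv : Continuous v) {c : ℝ} {x₀ : Plane}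
    (hvd : DifferentiableAt ℝ v x₀) (hx₀ : u x₀ = v x₀ + c)
    (hq : gradient v x₀ ∉ subdifferential u x₀) :
    ∃ z, ∀ᶠ x in nhds x₀, ∀ p ∈ subdifferential v x, u z < v x + c + inner ℝ p (z - x) := by
  simp only [subdifferential, Set.mem_ofPred_eq, not_forall, not_le] at hq
  obtain ⟨z, hz⟩ := hq
  refine ⟨z, ?_⟩
  -- Backward difference quotients in the direction `z - x` bound `⟪p, z - x⟫` from below for every
  -- subgradient `p` at `x`, and depend continuously on `x`.
  have hline : HasDerivAt (fun t : ℝ => v (x₀ - t • (z - x₀))) (-inner ℝ (gradient v x₀) (z - x₀))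
      0 := by
    have h1 : HasDerivAt (fun t : ℝ => x₀ - t • (z - x₀)) (-(z - x₀)) 0 := by
      simpa using ((hasDerivAt_id (0 : ℝ)).smul_const (z - x₀)).const_sub x₀
    have h2 : HasFDerivAt v (fderiv ℝ v x₀) (x₀ - (0 : ℝ) • (z - x₀)) := by
      simpa using hvd.hasFDerivAt
    have h3 := h2.comp_hasDerivAt (0 : ℝ) h1
    rwa [map_neg, ← toDual_gradient, InnerProductSpace.toDual_apply_apply] at h3
  have hlim := hline.tendsto_slope_zero_right
  simp only [zero_add, zero_smul, sub_zero, smul_eq_mul] at hlim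
  have hev : ∀ᶠ t : ℝ in nhdsWithin 0 (Set.Ioi 0),
      u z < v x₀ + c - t⁻¹ * (v (x₀ - t • (z - x₀)) - v x₀) := by
    refine (hlim.const_sub (v x₀ + c)).eventually_const_lt ?_
    rw [← hx₀]
    linarith
  obtain ⟨t, ht, ht0⟩ := (hev.and self_mem_nhdsWithin).exists
  have ht0 : 0 < t := ht0
  have hcont : Continuous fun x => v x + c - t⁻¹ * (v (x - t • (z - x)) - v x) := by fun_prop
  filter_upwards [hcont.continuousAt.eventually_const_lt ht] with x hx p hp
  have h1 := hp (x - t • (z - x))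
  have h2 : x - t • (z - x) - x = -(t • (z - x)) := by abel
  rw [h2, inner_neg_right, inner_smul_right] at h1
  have h3 : t⁻¹ * (v x - v (x - t • (z - x))) ≤ inner ℝ p (z - x) := by
    rw [inv_mul_le_iff₀ ht0]
    linarith
  linarith

/-- At a point of `{u = v + c}` where the gradients differ, `u - v` has no local maximum. -/
theorem inter_setOf_add_lt_nonempty_of_gradient_ne {u v : Plane → ℝ} {c : ℝ} {x₀ : Plane}
    (hud : DifferentiableAt ℝ u x₀) (hvd : DifferentiableAt ℝ v x₀) (hx₀ : u x₀ = v x₀ + c)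
    (hne : gradient u x₀ ≠ gradient v x₀) {B : Set Plane} (hB : B ∈ nhds x₀) :
    (B ∩ {x | v x + c < u x}).Nonempty := by
  by_contra hcon
  refine hne ?_
  have hmax : IsLocalMax (fun x => u x - v x) x₀ := by
    filter_upwards [hB] with x hx
    by_contra hlt
    exact hcon ⟨x, hx, by simp only [Set.mem_ofPred_eq]; linarith⟩
  have h0 := hmax.hasFDerivAt_eq_zero (hud.hasFDerivAt.sub hvd.hasFDerivAt)
  rw [gradient, gradient, sub_eq_zero.1 h0]

/-- Slopes of `u` on `{u > v + c}` are slopes of `v` only at points of that set. If the gradients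
differed at `x₀ ∈ {u = v + c}`, no slope of `v` near `x₀` would be such a slope of `u`, and the
normal image under `v` of `{u > v + c}` would have more weighted area than the one under `u`,
although both equal the area of `{u > v + c}`. -/
theorem gradient_eq_of_isBounded {α η : ℝ} (hα₀ : 0 < α) (hα₁ : α < 1 / 4) (hη : 0 ≤ η)
    {u v : Plane → ℝ} (hu : IsAlexandrovSolution α η u) (hv : IsAlexandrovSolution α η v)
    (hsurj : ∀ p, ∃ x, p ∈ subdifferential v x) {c : ℝ}
    (hb : Bornology.IsBounded {x | v x + c < u x}) {x₀ : Plane} (hx₀ : u x₀ = v x₀ + c)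
    (hud : DifferentiableAt ℝ u x₀) (hvd : DifferentiableAt ℝ v x₀) :
    gradient u x₀ = gradient v x₀ := by
  by_contra hne
  have huc : Continuous u := hu.1.locallyLipschitz.continuous
  have hvc : Continuous v := hv.1.locallyLipschitz.continuous
  set M : Set Plane := {x | v x + c < u x} with hM
  have hMo : IsOpen M := isOpen_lt (by fun_prop) huc
  obtain ⟨z, hz⟩ := exists_eventually_lt_add_inner hvc hvd hx₀
    (fun h => hne (eq_gradient_of_mem_subdifferential h hud).symm)
  obtain ⟨B, hBsub, hBo, hBx⟩ := mem_nhds_iff.1 hz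
  have hN := inter_setOf_add_lt_nonempty_of_gradient_ne hud hvd hx₀ hne (hBo.mem_nhds hBx)
  have hsub : normalImage u M ⊆ normalImage v (M \ B) := by
    intro p hp
    simp only [normalImage, Set.mem_iUnion] at hp
    obtain ⟨y, hyM, hpy⟩ := hp
    obtain ⟨x, hpx⟩ := hsurj p
    have hyM : v y + c < u y := hyM
    refine Set.mem_iUnion₂.2 ⟨x, ⟨?_, fun hxB => ?_⟩, hpx⟩
    · have h1 := hpy x
      have h2 := hpx y
      have h3 : inner ℝ p (y - x) = -inner ℝ p (x - y) := by
        rw [← inner_neg_right, neg_sub]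
      simp only [hM, Set.mem_ofPred_eq]
      linarith
    · have h1 := hpy z
      have h2 := hpx y
      have h3 := hBsub hxB p hpx
      have h4 : inner ℝ p (z - x) = inner ℝ p (z - y) + inner ℝ p (y - x) := by
        rw [← inner_add_right, sub_add_sub_cancel]
      linarith
  have hle : volume M ≤ volume (M \ B) := by
    rw [← lintegral_normalImage_inv hα₀ hα₁ hη hu hMo.measurableSet,
      ← lintegral_normalImage_inv hα₀ hα₁ hη hv (hMo.measurableSet.diff hBo.measurableSet)]
    exact lintegral_mono_set hsub
  have hMfin : volume (M \ B) ≠ ⊤ := (hb.subset Set.sdiff_subset).measure_lt_top.ne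
  have hpos : 0 < volume (B ∩ M) := (hBo.inter hMo).measure_pos volume hN
  have hsum := measure_inter_add_sdiff (μ := volume) M hBo.measurableSet
  rw [Set.inter_comm M B] at hsum
  have : volume (M \ B) < volume M := by
    rw [← hsum, add_comm]
    exact ENNReal.lt_add_right hMfin hpos.ne'
  exact absurd hle (not_le.2 this)

theorem exists_lipschitzWith_of_bounded_support {f : Plane → ℝ} (hf : LocallyLipschitz f)
    (h0 : ∀ x, 0 ≤ f x) {R : ℝ} (hR : ∀ x, R < ‖x‖ → f x = 0) : ∃ K, LipschitzWith K f := by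
  obtain ⟨K, hK⟩ := (hf.locallyLipschitzOn
    (s := Metric.closedBall (0 : Plane) (R + 1))).exists_lipschitzOnWith_of_compact
      (isCompact_closedBall _ _)
  obtain ⟨b, hb⟩ := ((isCompact_closedBall (0 : Plane) R).image hf.continuous).isBounded.bddAbove
  have hfb : ∀ x, f x ≤ max b 0 := by
    intro x
    by_cases hx : ‖x‖ ≤ R
    · exact (hb ⟨x, by simpa using hx, rfl⟩).trans (le_max_left _ _)
    · rw [hR x (not_le.1 hx)]
      exact le_max_right _ _
  refine ⟨max K (max b 0).toNNReal, LipschitzWith.of_dist_le_mul fun x y => ?_⟩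
  rw [NNReal.coe_max, Real.coe_toNNReal _ (le_max_right _ _)]
  have hbig : f x ≤ max b 0 ∧ f y ≤ max b 0 := ⟨hfb x, hfb y⟩
  have hm := le_max_right (K : ℝ) (max b 0)
  have hm0 : 0 ≤ max (K : ℝ) (max b 0) := (le_max_right b 0).trans hm
  by_cases hd : dist x y ≤ 1
  · by_cases hx : ‖x‖ ≤ R + 1 ∧ ‖y‖ ≤ R + 1
    · refine (hK.dist_le_mul x (by simpa using hx.1) y (by simpa using hx.2)).trans ?_
      gcongr
      exact le_max_left _ _
    · have hxy : R < ‖x‖ ∧ R < ‖y‖ := by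
        have h1 : |‖x‖ - ‖y‖| ≤ 1 := (abs_norm_sub_norm_le x y).trans (by rwa [← dist_eq_norm])
        rw [abs_le] at h1
        by_contra hcon
        apply hx
        by_cases h2 : R < ‖x‖
        · have h3 : ‖y‖ ≤ R := not_lt.1 fun h => hcon ⟨h2, h⟩
          constructor <;> linarith
        · constructor <;> linarith
      rw [hR x hxy.1, hR y hxy.2, dist_self]
      positivity
  · have h1 : |f x - f y| ≤ max b 0 := by
      rw [abs_le]
      constructor <;> linarith [h0 x, h0 y, hbig.1, hbig.2]
    rw [Real.dist_eq]
    nlinarith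

/-- Integrating by parts against a coordinate function shows that `f` has integral zero. -/
theorem eq_zero_of_ae_fderiv_eq_zero {f : Plane → ℝ} (hf : LocallyLipschitz f) (h0 : ∀ x, 0 ≤ f x)
    {R : ℝ} (hR : ∀ x, R < ‖x‖ → f x = 0)
    (hd : ∀ᵐ x, DifferentiableAt ℝ f x → fderiv ℝ f x = 0) : f = 0 := by
  obtain ⟨K, hK⟩ := exists_lipschitzWith_of_bounded_support hf h0 hR
  have hsupp : HasCompactSupport f := by
    refine HasCompactSupport.intro (isCompact_closedBall (0 : Plane) R) fun x hx => hR x ?_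
    simpa using hx
  let e : Plane := EuclideanSpace.single 0 1
  have hcoord := (innerSL ℝ e).lipschitz
  have hparts := hcoord.integral_lineDeriv_mul_eq (μ := volume) hK hsupp e
  have hleft : ∀ x, lineDeriv ℝ (innerSL ℝ e) x e = 1 := by
    intro x
    rw [(innerSL ℝ e).differentiableAt.lineDeriv_eq_fderiv, ContinuousLinearMap.fderiv]
    simp [e]
  have hright : ∀ᵐ x, lineDeriv ℝ f x (-e) * innerSL ℝ e x = 0 := by
    filter_upwards [hK.ae_differentiableAt (μ := volume), hd] with x hx hdx
    rw [hx.lineDeriv_eq_fderiv, hdx hx]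
    simp
  rw [integral_congr_ae hright] at hparts
  simp only [hleft, one_mul, integral_zero] at hparts
  have hint : Integrable f := hf.continuous.integrable_of_hasCompactSupport hsupp
  have := (integral_eq_zero_iff_of_nonneg h0 hint).1 hparts
  exact (Continuous.ae_eq_iff_eq volume hf.continuous continuous_zero).1 this

/-- The comparison principle for entire solutions, one of which has every slope. -/
theorem le_of_isBounded_setOf_add_lt {α η : ℝ} (hα₀ : 0 < α) (hα₁ : α < 1 / 4) (hη : 0 ≤ η)
    {u v : Plane → ℝ} (hu : IsAlexandrovSolution α η u) (hv : IsAlexandrovSolution α η v)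
    (hsurj : ∀ p, ∃ x, p ∈ subdifferential v x)
    (hb : ∀ c > 0, Bornology.IsBounded {x | v x + c < u x}) (x : Plane) : u x ≤ v x := by
  refine le_of_forall_pos_le_add fun c hc => ?_
  have hul := hu.1.locallyLipschitz
  have hvl := hv.1.locallyLipschitz
  set f : Plane → ℝ := fun x => max (u x - v x - c) 0 with hf
  have hfl : LocallyLipschitz f := ((hul.sub hvl).sub (LocallyLipschitz.const c)).max_const 0
  have hf0 : ∀ x, 0 ≤ f x := fun x => le_max_right _ _
  obtain ⟨R, hR⟩ := (hb c hc).exists_norm_le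
  have hsupp : ∀ x, R < ‖x‖ → f x = 0 := by
    intro x hx
    refine max_eq_right ?_
    by_contra hlt
    exact absurd (hR x (by simp only [Set.mem_ofPred_eq]; linarith)) (not_le.2 hx)
  have hd : ∀ᵐ x, DifferentiableAt ℝ f x → fderiv ℝ f x = 0 := by
    filter_upwards [hu.1.ae_differentiableAt, hv.1.ae_differentiableAt] with x hux hvx hfx
    rcases (hf0 x).eq_or_lt with h0 | hpos
    · -- `f` is nonnegative, so its zeros are minima.
      have hmin : IsLocalMin f x := Eventually.of_forall fun y => h0 ▸ hf0 y
      exact hmin.fderiv_eq_zero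
    · have hlt : 0 < u x - v x - c := by
        rcases lt_max_iff.1 hpos with h | h
        · exact h
        · exact absurd h (lt_irrefl _)
      have hgrad := gradient_eq_of_isBounded (c := u x - v x) hα₀ hα₁ hη hu hv hsurj
        (hb _ (by linarith)) (by ring) hux hvx
      have hev : f =ᶠ[nhds x] fun y => u y - v y - c := by
        have hcont : Continuous fun y => u y - v y - c :=
          (hul.continuous.sub hvl.continuous).sub continuous_const
        filter_upwards [hcont.continuousAt.eventually_const_lt hlt] with y hy
        exact max_eq_left hy.le
      have hfd : fderiv ℝ u x = fderiv ℝ v x := by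
        rw [← toDual_gradient, ← toDual_gradient, hgrad]
      have hsub : HasFDerivAt (fun y => u y - v y - c) (fderiv ℝ u x - fderiv ℝ v x) x :=
        (hux.hasFDerivAt.sub hvx.hasFDerivAt).sub_const c
      rw [hev.fderiv_eq, hsub.fderiv, hfd, sub_self]
  have hzero := congrFun (eq_zero_of_ae_fderiv_eq_zero hfl hf0 hsupp hd) x
  have := le_max_left (u x - v x - c) 0
  simp only [hf, Pi.zero_apply] at hzero
  linarith

/-! ### Support functions of level sets -/

theorem inner_angle (x : Plane) (θ : ℝ) :
    inner ℝ x !₂[Real.cos θ, Real.sin θ] = x 0 * Real.cos θ + x 1 * Real.sin θ := by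
  simp [PiLp.inner_apply, Fin.sum_univ_two, mul_comm]

theorem exists_eq_norm_smul_angle (w : Plane) :
    ∃ θ : ℝ, w = ‖w‖ • (!₂[Real.cos θ, Real.sin θ] : Plane) := by
  let z : ℂ := ⟨w 0, w 1⟩
  have hz : ‖w‖ = ‖z‖ := by
    rw [EuclideanSpace.norm_eq, Complex.norm_eq_sqrt_sq_add_sq]
    simp [Fin.sum_univ_two, z]
  refine ⟨z.arg, ?_⟩
  ext i
  fin_cases i
  · simp [hz, z]
  · simp [hz, z]

/-- A positive supremum is not the junk value `0` that `sSup` takes at empty and at unbounded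
sets. -/
theorem levelSet_nonempty_and_bddAbove {u : Plane → ℝ} {l θ : ℝ} (hpos : 0 < levelSupport u l θ) :
    {x | u x = l}.Nonempty ∧
      BddAbove ((fun x : Plane => (inner ℝ x !₂[Real.cos θ, Real.sin θ] : ℝ)) '' {x | u x = l}) := by
  constructor
  · by_contra h
    rw [Set.not_nonempty_iff_eq_empty] at h
    rw [levelSupport, h, Set.image_empty, Real.sSup_empty] at hpos
    exact lt_irrefl _ hpos
  · by_contra h
    rw [levelSupport, Real.sSup_of_not_bddAbove h] at hpos
    exact lt_irrefl _ hpos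

theorem isBounded_levelSet {u : Plane → ℝ} {l : ℝ} (hpos : ∀ θ, 0 < levelSupport u l θ) :
    Bornology.IsBounded {x | u x = l} := by
  have hb := fun θ => (levelSet_nonempty_and_bddAbove (hpos θ)).2
  obtain ⟨a, ha⟩ := hb 0
  obtain ⟨b, hb'⟩ := hb Real.pi
  obtain ⟨c, hc⟩ := hb (Real.pi / 2)
  obtain ⟨d, hd⟩ := hb (-(Real.pi / 2))
  refine isBounded_iff_forall_norm_le.2 ⟨max a b + max c d, fun x hx => ?_⟩
  have h1 := (inner_angle x _).symm.trans_le (ha ⟨x, hx, rfl⟩)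
  have h2 := (inner_angle x _).symm.trans_le (hb' ⟨x, hx, rfl⟩)
  have h3 := (inner_angle x _).symm.trans_le (hc ⟨x, hx, rfl⟩)
  have h4 := (inner_angle x _).symm.trans_le (hd ⟨x, hx, rfl⟩)
  simp only [Real.cos_zero, Real.sin_zero, Real.cos_pi, Real.sin_pi,
    Real.cos_pi_div_two, Real.sin_pi_div_two, Real.cos_neg, Real.sin_neg] at h1 h2 h3 h4
  have h5 : |x 0| ≤ max a b :=
    abs_le'.2 ⟨le_max_of_le_left (by linarith), le_max_of_le_right (by linarith)⟩
  have h6 : |x 1| ≤ max c d :=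
    abs_le'.2 ⟨le_max_of_le_left (by linarith), le_max_of_le_right (by linarith)⟩
  have h7 : ‖x‖ ≤ |x 0| + |x 1| := by
    rw [EuclideanSpace.norm_eq, Fin.sum_univ_two]
    refine Real.sqrt_le_iff.2 ⟨by positivity, ?_⟩
    simp only [Real.norm_eq_abs]
    nlinarith [mul_nonneg (abs_nonneg (x 0)) (abs_nonneg (x 1))]
  linarith

theorem one_lt_rank_plane : 1 < Module.rank ℝ Plane := by
  rw [← Module.finrank_eq_rank]
  simp

theorem isPreconnected_compl_closedBall_plane {R : ℝ} (hR : 0 ≤ R) :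
    IsPreconnected {x : Plane | R < ‖x‖} := by
  have hS := isPreconnected_sphere one_lt_rank_plane (0 : Plane) 1
  have himg := (isPreconnected_Ioi (a := R)).prod hS |>.image
    (fun q : ℝ × Plane => q.1 • q.2) (by fun_prop)
  convert himg using 1
  ext x
  constructor
  · intro hx
    have hx0 : ‖x‖ ≠ 0 := (hR.trans_lt hx).ne'
    refine ⟨(‖x‖, ‖x‖⁻¹ • x), ⟨hx, ?_⟩, smul_inv_smul₀ hx0 x⟩
    simp [norm_smul, hx0]
  · rintro ⟨⟨r, y⟩, ⟨hr, hy⟩, rfl⟩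
    have hr : R < r := hr
    have hy : ‖y‖ = 1 := by simpa using hy
    simp only [Set.mem_ofPred_eq, norm_smul, hy, mul_one, Real.norm_eq_abs]
    exact hr.trans_le (le_abs_self r)

/-- The exterior of a disc containing the level set is connected, so `u < l` somewhere in it
would give `u < l` in all of it, and then everywhere by convexity. -/
theorem exists_forall_norm_lt_imp_lt {u : Plane → ℝ} (hu : ConvexOn ℝ Set.univ u) {l : ℝ}
    (hpos : ∀ θ, 0 < levelSupport u l θ) : ∃ R, 0 ≤ R ∧ ∀ x, R < ‖x‖ → l < u x := by
  obtain ⟨R, hR⟩ := (isBounded_levelSet hpos).exists_norm_le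
  obtain ⟨x₀, hx₀⟩ := (levelSet_nonempty_and_bddAbove (hpos 0)).1
  have hR0 : 0 ≤ R := (norm_nonneg _).trans (hR _ hx₀)
  have hx₀ : u x₀ = l := hx₀
  refine ⟨R, hR0, fun x hx => ?_⟩
  by_contra hle
  have hlt : ∀ y, R < ‖y‖ → u y < l := by
    intro y hy
    by_contra hge
    obtain ⟨z, hz, hzl⟩ := (isPreconnected_compl_closedBall_plane hR0).intermediate_value hx hy
      hu.locallyLipschitz.continuous.continuousOn ⟨not_lt.1 hle, not_lt.1 hge⟩
    exact absurd (hR z hzl) (not_le.2 hz)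
  obtain ⟨w, hw⟩ : ∃ w : Plane, ‖w‖ = R + ‖x₀‖ + 1 :=
    ⟨(R + ‖x₀‖ + 1) • EuclideanSpace.single 0 1, by
      rw [norm_smul, Real.norm_of_nonneg (by positivity)]; simp⟩
  have h1 : R < ‖x₀ + w‖ := by
    have := norm_sub_norm_le w (-x₀)
    rw [sub_neg_eq_add, norm_neg, add_comm w] at this
    linarith
  have h2 : R < ‖x₀ - w‖ := by
    have := norm_sub_norm_le w x₀
    rw [norm_sub_rev] at this
    linarith
  have hmid := hu.2 (Set.mem_univ (x₀ + w)) (Set.mem_univ (x₀ - w))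
    (by norm_num : (0 : ℝ) ≤ 1 / 2) (by norm_num : (0 : ℝ) ≤ 1 / 2) (by norm_num)
  have hx : (1 / 2 : ℝ) • (x₀ + w) + (1 / 2 : ℝ) • (x₀ - w) = x₀ := by
    module
  rw [hx, hx₀] at hmid
  have h3 := hlt _ h1
  have h4 := hlt _ h2
  simp only [smul_eq_mul] at hmid
  linarith

theorem inner_le_levelSupport {u : Plane → ℝ} (hu : ConvexOn ℝ Set.univ u) {l : ℝ}
    (hpos : ∀ θ, 0 < levelSupport u l θ) {x : Plane} (hx : u x ≤ l) (θ : ℝ) :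
    inner ℝ x !₂[Real.cos θ, Real.sin θ] ≤ levelSupport u l θ := by
  obtain ⟨R, hR0, hR⟩ := exists_forall_norm_lt_imp_lt hu hpos
  set e : Plane := !₂[Real.cos θ, Real.sin θ] with he
  have he1 : inner ℝ e e = (1 : ℝ) := by
    rw [he, inner_angle]
    simp only [Matrix.cons_val_zero, Matrix.cons_val_one]
    nlinarith [Real.sin_sq_add_cos_sq θ]
  have hen : ‖e‖ = 1 := by
    rw [← sq_eq_sq₀ (norm_nonneg _) zero_le_one, ← real_inner_self_eq_norm_sq, he1, one_pow]
  have hfar : l < u (x + (R + ‖x‖ + 1) • e) := by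
    refine hR _ ?_
    have h1 := norm_sub_norm_le ((R + ‖x‖ + 1) • e) (-x)
    rw [sub_neg_eq_add, norm_neg, add_comm _ x, norm_smul, hen,
      Real.norm_of_nonneg (by positivity)] at h1
    linarith
  have hcont : Continuous fun t : ℝ => u (x + t • e) :=
    hu.locallyLipschitz.continuous.comp (by fun_prop)
  obtain ⟨t, ht, htl⟩ := intermediate_value_Icc (by positivity : (0 : ℝ) ≤ R + ‖x‖ + 1)
    hcont.continuousOn ⟨by simpa using hx, hfar.le⟩
  have hle : inner ℝ (x + t • e) e ≤ levelSupport u l θ :=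
    le_csSup (levelSet_nonempty_and_bddAbove (hpos θ)).2 ⟨_, htl, rfl⟩
  rw [inner_add_left, real_inner_smul_left, he1] at hle
  linarith [ht.1]

theorem exists_inner_eq_levelSupport {u : Plane → ℝ} (hu : Continuous u) {l : ℝ}
    (hpos : ∀ θ, 0 < levelSupport u l θ) (θ : ℝ) :
    ∃ x, u x = l ∧ inner ℝ x !₂[Real.cos θ, Real.sin θ] = levelSupport u l θ := by
  have hcomp : IsCompact {x | u x = l} :=
    Metric.isCompact_of_isClosed_isBounded (isClosed_eq hu continuous_const)
      (isBounded_levelSet hpos)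
  obtain ⟨x, hx, hxe⟩ := (hcomp.image
    (f := fun x : Plane => (inner ℝ x !₂[Real.cos θ, Real.sin θ] : ℝ)) (by fun_prop)).sSup_mem
    ((levelSet_nonempty_and_bddAbove (hpos θ)).1.image _)
  exact ⟨x, hx, hxe⟩

/-- A sublevel set is the intersection of its supporting half-planes. -/
theorem le_of_forall_inner_le_levelSupport {u : Plane → ℝ} (hu : ConvexOn ℝ Set.univ u) {l : ℝ}
    (hpos : ∀ θ, 0 < levelSupport u l θ) {x : Plane}
    (hx : ∀ θ, inner ℝ x !₂[Real.cos θ, Real.sin θ] ≤ levelSupport u l θ) : u x ≤ l := by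
  by_contra hlt
  have huc := hu.locallyLipschitz.continuous
  have hconv : Convex ℝ {y | u y ≤ l} := by simpa using hu.convex_le l
  obtain ⟨f, c, hf, hfx⟩ := geometric_hahn_banach_closed_point hconv
    (isClosed_le huc continuous_const) hlt
  set w := (InnerProductSpace.toDual ℝ Plane).symm f with hw
  have hfw : ∀ y, f y = inner ℝ w y := fun y => by
    rw [hw, InnerProductSpace.toDual_symm_apply]
  obtain ⟨θ, hθ⟩ := exists_eq_norm_smul_angle w
  obtain ⟨b, hb, hbe⟩ := exists_inner_eq_levelSupport huc hpos θ
  have h1 := (hf b hb.le).trans hfx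
  rw [hfw, hfw, hθ, real_inner_smul_left, real_inner_smul_left, real_inner_comm, hbe,
    real_inner_comm] at h1
  exact absurd h1 (not_lt.2 (mul_le_mul_of_nonneg_left (hx θ) (norm_nonneg _)))

theorem norm_le_levelSupport {u : Plane → ℝ} (hu : ConvexOn ℝ Set.univ u) {l : ℝ}
    (hpos : ∀ θ, 0 < levelSupport u l θ) {x : Plane} (hx : u x ≤ l) :
    ∃ θ, ‖x‖ ≤ levelSupport u l θ := by
  obtain ⟨θ, hθ⟩ := exists_eq_norm_smul_angle x
  refine ⟨θ, le_of_eq_of_le ?_ (inner_le_levelSupport hu hpos hx θ)⟩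
  conv_rhs => rw [hθ]
  rw [real_inner_smul_left, inner_angle]
  simp only [Matrix.cons_val_zero, Matrix.cons_val_one]
  linear_combination (-‖x‖) * Real.sin_sq_add_cos_sq θ

/-- The support function of the level sets of a convex function is concave in the height. -/
theorem levelSupport_concave {u : Plane → ℝ} (hu : ConvexOn ℝ Set.univ u) {l l' s t : ℝ}
    (hl : ∀ θ, 0 < levelSupport u l θ) (hl' : ∀ θ, 0 < levelSupport u l' θ)
    (hm : ∀ θ, 0 < levelSupport u (s * l + t * l') θ) (hs : 0 ≤ s) (ht : 0 ≤ t) (hst : s + t = 1)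
    (θ : ℝ) : s * levelSupport u l θ + t * levelSupport u l' θ ≤
      levelSupport u (s * l + t * l') θ := by
  have huc := hu.locallyLipschitz.continuous
  obtain ⟨x, hx, hxe⟩ := exists_inner_eq_levelSupport huc hl θ
  obtain ⟨y, hy, hye⟩ := exists_inner_eq_levelSupport huc hl' θ
  have h1 := hu.2 (Set.mem_univ x) (Set.mem_univ y) hs ht hst
  rw [hx, hy] at h1
  have h2 := inner_le_levelSupport hu hm h1 θ
  rwa [inner_add_left, real_inner_smul_left, real_inner_smul_left, hxe, hye] at h2

/-- If the level sets grow slower than the height, then `u` grows faster than every linear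
function, and `u - ⟪p, ·⟫` attains its minimum for every slope `p`. -/
theorem exists_mem_subdifferential {u : Plane → ℝ} (hu : ConvexOn ℝ Set.univ u)
    (hpos : ∀ᶠ l in atTop, ∀ θ, 0 < levelSupport u l θ)
    (hlin : ∀ ε > 0, ∀ᶠ l in atTop, ∀ θ, levelSupport u l θ ≤ ε * l) (p : Plane) :
    ∃ x, p ∈ subdifferential u x := by
  have hp1 : 0 < ‖p‖ + 1 := by positivity
  obtain ⟨L, hL⟩ := eventually_atTop.1 (hpos.and (hlin (‖p‖ + 1)⁻¹ (inv_pos.2 hp1)))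
  obtain ⟨R, -, hR⟩ := exists_forall_norm_lt_imp_lt hu (hL L le_rfl).1
  have huc := hu.locallyLipschitz.continuous
  have hgrow : ∀ x, R < ‖x‖ → ‖x‖ ≤ u x - inner ℝ p x := by
    intro x hx
    have hLx := hL (u x) (hR x hx).le
    obtain ⟨θ, hθ⟩ := norm_le_levelSupport hu hLx.1 le_rfl
    have h1 := hθ.trans (hLx.2 θ)
    rw [inv_mul_eq_div, le_div_iff₀ hp1] at h1
    have h2 := real_inner_le_norm p x
    linarith
  obtain ⟨x, hx⟩ := Continuous.exists_forall_le_of_isBounded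
    (f := fun x => u x - inner ℝ p x) (by fun_prop) 0 (isBounded_iff_forall_norm_le.2
      ⟨max R (u 0), fun x hx => by
        by_contra hlt
        obtain ⟨h1, h2⟩ := max_lt_iff.1 (not_le.1 hlt)
        have h3 := hgrow x h1
        have h4 : u x - inner ℝ p x ≤ u 0 - inner ℝ p (0 : Plane) := hx
        rw [inner_zero_right] at h4
        linarith⟩)
  refine ⟨x, fun y => ?_⟩
  have := hx y
  rw [inner_sub_right]
  linarith

/-! ### The asymptotics of the level sets -/

theorem IsShrinkerSupport.exists_bounds {α : ℝ} {h : ℝ → ℝ} (hh : IsShrinkerSupport α h) :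
    ∃ m H, 0 < m ∧ ∀ θ, m ≤ h θ ∧ h θ ≤ H := by
  have hne : (Set.Icc 0 (2 * Real.pi)).Nonempty := ⟨0, le_rfl, by positivity⟩
  have hc := hh.smooth.continuous.continuousOn (s := Set.Icc 0 (2 * Real.pi))
  obtain ⟨a, -, ha⟩ := isCompact_Icc.exists_isMinOn hne hc
  obtain ⟨b, -, hb⟩ := isCompact_Icc.exists_isMaxOn hne hc
  refine ⟨h a, h b, hh.pos a, fun θ => ?_⟩
  obtain ⟨y, hy, hyθ⟩ := hh.periodic.exists_mem_Ico₀ (by positivity) θ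
  rw [hyθ]
  exact ⟨ha (Set.Ico_subset_Icc_self hy), hb (Set.Ico_subset_Icc_self hy)⟩

theorem eventually_levelSupport_pos {u : Plane → ℝ} {σ m : ℝ} (hσ : 0 < σ) {h : ℝ → ℝ}
    (hm : 0 < m) (hhm : ∀ θ, m ≤ h θ)
    (hS : UniformLittleO (fun l θ => levelSupport u l θ - σ⁻¹ * l ^ σ * h θ) σ) :
    ∀ᶠ l in atTop, ∀ θ, 0 < levelSupport u l θ := by
  filter_upwards [hS (σ⁻¹ * m / 2) (by positivity), eventually_gt_atTop 0] with l hl hl0 θ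
  have h1 := (abs_le.1 (hl θ)).1
  have h2 : 0 < σ⁻¹ * l ^ σ := by positivity
  have h3 := mul_le_mul_of_nonneg_left (hhm θ) h2.le
  have h4 : 0 < σ⁻¹ * l ^ σ * m := by positivity
  linarith

theorem eventually_levelSupport_le_mul {u : Plane → ℝ} {σ H : ℝ} (hσ : 0 < σ) (hσ1 : σ < 1)
    {h : ℝ → ℝ} (hhH : ∀ θ, h θ ≤ H)
    (hS : UniformLittleO (fun l θ => levelSupport u l θ - σ⁻¹ * l ^ σ * h θ) σ)
    {ε : ℝ} (hε : 0 < ε) : ∀ᶠ l in atTop, ∀ θ, levelSupport u l θ ≤ ε * l := by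
  have hlim : Tendsto (fun l : ℝ => (σ⁻¹ * H + 1) * l ^ (-(1 - σ))) atTop (nhds 0) := by
    simpa using (tendsto_rpow_neg_atTop (by linarith : 0 < 1 - σ)).const_mul (σ⁻¹ * H + 1)
  filter_upwards [hS 1 one_pos, eventually_gt_atTop 0, hlim.eventually_lt_const hε]
    with l hl hl0 hlε θ
  have h1 := (abs_le.1 (hl θ)).2
  have h2 : 0 < σ⁻¹ * l ^ σ := by positivity
  have h3 := mul_le_mul_of_nonneg_left (hhH θ) h2.le
  have h4 : l ^ σ = l ^ (-(1 - σ)) * l := by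
    rw [← Real.rpow_add_one hl0.ne']
    congr 1
    ring
  have h5 := mul_le_mul_of_nonneg_right hlε.le hl0.le
  rw [mul_assoc, ← h4] at h5
  linarith

/-- Concavity in the height turns the growth of the support function between `l` and `2 * l` into a
lower bound, of order `l ^ (σ - 1)`, for its growth between `l` and `l + ε`. -/
theorem eventually_levelSupport_add_le {u : Plane → ℝ} (hu : ConvexOn ℝ Set.univ u) {σ m : ℝ}
    (hσ : 0 < σ) {h : ℝ → ℝ} (hm : 0 < m) (hhm : ∀ θ, m ≤ h θ)
    (hS : UniformLittleO (fun l θ => levelSupport u l θ - σ⁻¹ * l ^ σ * h θ) σ)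
    {ε : ℝ} (hε : 0 < ε) :
    ∃ δ > 0, ∀ᶠ l in atTop, ∀ θ,
      levelSupport u l θ + δ * l ^ (σ - 1) ≤ levelSupport u (l + ε) θ := by
  have h2σ : 1 < (2 : ℝ) ^ σ := Real.one_lt_rpow one_lt_two hσ
  set κ := σ⁻¹ * m * ((2 : ℝ) ^ σ - 1) with hκ
  have hκ0 : 0 < κ := by
    have : 0 < (2 : ℝ) ^ σ - 1 := by linarith
    positivity
  refine ⟨ε * κ / 2, by positivity, ?_⟩
  obtain ⟨L, hL⟩ := eventually_atTop.1 (hS (κ / (2 * ((2 : ℝ) ^ σ + 1))) (by positivity))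
  obtain ⟨L', hL'⟩ := eventually_atTop.1 (eventually_levelSupport_pos hσ hm hhm hS)
  filter_upwards [eventually_ge_atTop L, eventually_ge_atTop L', eventually_gt_atTop 0,
    eventually_ge_atTop ε] with l hlL hlL' hl0 hlε θ
  have hε' : κ / (2 * ((2 : ℝ) ^ σ + 1)) * ((2 : ℝ) ^ σ + 1) = κ / 2 := by
    field_simp
  set ε' := κ / (2 * ((2 : ℝ) ^ σ + 1))
  have h1 := (abs_le.1 (hL l hlL θ)).2
  have h2 := (abs_le.1 (hL (2 * l) (by linarith) θ)).1
  dsimp only at h1 h2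
  rw [Real.mul_rpow two_pos.le hl0.le] at h2
  have hlσ : 0 < l ^ σ := by positivity
  have hdouble : levelSupport u l θ + κ / 2 * l ^ σ ≤ levelSupport u (2 * l) θ := by
    have h3 : κ * l ^ σ ≤ σ⁻¹ * ((2 : ℝ) ^ σ - 1) * l ^ σ * h θ := by
      have h4 : 0 ≤ σ⁻¹ * ((2 : ℝ) ^ σ - 1) * l ^ σ := by
        have : 0 < (2 : ℝ) ^ σ - 1 := by linarith
        positivity
      have := mul_le_mul_of_nonneg_left (hhm θ) h4
      rw [hκ]
      linarith
    have h5 : ε' * (2 ^ σ * l ^ σ) + ε' * l ^ σ = κ / 2 * l ^ σ := by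
      rw [← hε']
      ring
    linarith
  have hcomb : (1 - ε / l) * l + ε / l * (2 * l) = l + ε := by
    field_simp
    ring
  have hconc := levelSupport_concave hu (hL' l hlL') (hL' (2 * l) (by linarith))
    (by rw [hcomb]; exact hL' _ (by linarith)) (s := 1 - ε / l) (t := ε / l)
    (by rw [sub_nonneg, div_le_one hl0]; exact hlε) (by positivity) (by ring) θ
  rw [hcomb] at hconc
  have hpow : l ^ (σ - 1) = l ^ σ / l := by
    rw [Real.rpow_sub_one hl0.ne']
  have h6 : ε / l * (κ / 2 * l ^ σ) = ε * κ / 2 * l ^ (σ - 1) := by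
    rw [hpow]
    field_simp
  have h7 := mul_le_mul_of_nonneg_left hdouble (by positivity : 0 ≤ ε / l)
  linarith

/-- A difference `o(l ^ (σ - 1))` of the support functions is absorbed by an arbitrarily small
increase of the height: the difference of the two functions tends to zero at infinity. -/
theorem isBounded_setOf_add_lt {u v : Plane → ℝ} (hu : ConvexOn ℝ Set.univ u)
    (hv : ConvexOn ℝ Set.univ v) {σ m : ℝ} (hσ : 0 < σ) {h : ℝ → ℝ} (hm : 0 < m)
    (hhm : ∀ θ, m ≤ h θ)
    (hSu : UniformLittleO (fun l θ => levelSupport u l θ - σ⁻¹ * l ^ σ * h θ) σ)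
    (hSv : UniformLittleO (fun l θ => levelSupport v l θ - σ⁻¹ * l ^ σ * h θ) σ)
    (hd : UniformLittleO (fun l θ => levelSupport u l θ - levelSupport v l θ) (σ - 1))
    {ε : ℝ} (hε : 0 < ε) : Bornology.IsBounded {x | v x + ε < u x} := by
  obtain ⟨δ, hδ, hinc⟩ := eventually_levelSupport_add_le hu hσ hm hhm hSu hε
  obtain ⟨L, hL⟩ := eventually_atTop.1 (((hinc.and (hd δ hδ)).and
    (eventually_levelSupport_pos hσ hm hhm hSu)).and (eventually_levelSupport_pos hσ hm hhm hSv))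
  obtain ⟨R, -, hR⟩ := exists_forall_norm_lt_imp_lt hv (hL L le_rfl).2
  refine isBounded_iff_forall_norm_le.2 ⟨R, fun x hx => ?_⟩
  by_contra hlt
  have hl := hR x (not_le.1 hlt)
  obtain ⟨⟨⟨h1, h2⟩, -⟩, h3⟩ := hL (v x) hl.le
  refine absurd hx (not_lt.2 (le_of_forall_inner_le_levelSupport hu
    (hL (v x + ε) (by linarith)).1.2 fun θ => ?_))
  have h4 := inner_le_levelSupport hv h3 le_rfl θ
  have h5 := (abs_le.1 (h2 θ)).1
  linarith [h1 θ]

theorem UniformLittleO.sub_comm {f g : ℝ → ℝ → ℝ} {γ : ℝ}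
    (h : UniformLittleO (fun l θ => f l θ - g l θ) γ) :
    UniformLittleO (fun l θ => g l θ - f l θ) γ := by
  intro ε hε
  filter_upwards [h ε hε] with l hl θ
  rw [abs_sub_comm]
  exact hl θ

theorem lemma4p2 (α η : ℝ) (hα₀ : 0 < α) (hα₁ : α < 1 / 4) (hη : η = 0 ∨ η = 1)
    (h : ℝ → ℝ) (hh : IsShrinkerSupport α h)
    (u₁ u₂ : Plane → ℝ)
    (hu₁ : IsAlexandrovSolution α η u₁) (hu₂ : IsAlexandrovSolution α η u₂)
    (hS₁ : UniformLittleO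
      (fun l θ => levelSupport u₁ l θ - (1 - 2 * α)⁻¹ * l ^ (1 - 2 * α) * h θ) (1 - 2 * α))
    (hS₂ : UniformLittleO
      (fun l θ => levelSupport u₂ l θ - (1 - 2 * α)⁻¹ * l ^ (1 - 2 * α) * h θ) (1 - 2 * α))
    (hS₁₂ : UniformLittleO
      (fun l θ => levelSupport u₁ l θ - levelSupport u₂ l θ) (-(2 * α))) :
    Set.graphOn u₁ Set.univ = Set.graphOn u₂ Set.univ := by
  have hη0 : 0 ≤ η := by rcases hη with rfl | rfl <;> norm_num
  have hσ : 0 < 1 - 2 * α := by linarith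
  have hσ1 : 1 - 2 * α < 1 := by linarith
  obtain ⟨m, H, hm, hmH⟩ := hh.exists_bounds
  have hhm := fun θ => (hmH θ).1
  have hhH := fun θ => (hmH θ).2
  rw [show -(2 * α) = 1 - 2 * α - 1 by ring] at hS₁₂
  have hle : u₁ = u₂ := funext fun x => le_antisymm
    (le_of_isBounded_setOf_add_lt hα₀ hα₁ hη0 hu₁ hu₂
      (exists_mem_subdifferential hu₂.1 (eventually_levelSupport_pos hσ hm hhm hS₂)
        fun ε hε => eventually_levelSupport_le_mul hσ hσ1 hhH hS₂ hε)
      (fun c hc => isBounded_setOf_add_lt hu₁.1 hu₂.1 hσ hm hhm hS₁ hS₂ hS₁₂ hc) x)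
    (le_of_isBounded_setOf_add_lt hα₀ hα₁ hη0 hu₂ hu₁
      (exists_mem_subdifferential hu₁.1 (eventually_levelSupport_pos hσ hm hhm hS₁)
        fun ε hε => eventually_levelSupport_le_mul hσ hσ1 hhH hS₁ hε)
      (fun c hc => isBounded_setOf_add_lt hu₂.1 hu₁.1 hσ hm hhm hS₂ hS₁ hS₁₂.sub_comm hc) x)
  rw [hle]
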